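/- Let $n>1$ and let $K_n=\langle a_1,\dots,a_n \mid a_i^2=a_i\ (1\le i\le n),\ a_ia_ja_i=a_ja_ia_j=a_ia_j\ (1\le j<i\le n)\rangle$ be Kiselman's semigroup (a monoid with unit element $e$), and let $f=a_na_{n-1}\cdots a_1$, which is the zero element of $K_n$. Let $(X_j)_{j\ge 1}$ be independent and identically distributed random variables on a probability space $(\Omega,\mathcal F,\mathbb P)$ with values in $\{a_1,\dots,a_n\}$, and assume that $p_i=\mathbb P(X_1=a_i)>0$ for every $i=1,\dots,n$. Put $P_0=e$ and $P_j=X_1X_2\cdots X_j\in K_n$ for $j\ge 1$, and let $T=\inf\{j\ge 0 \mid P_j=f\}$, with $T=\infty$ if no such $j$ exists. Then $T$ has the same distribution as a sum $G_1+\dots+G_n$ of independent random variables, where $G_i$ is geometric on $\{1,2,3,\dots\}$ with success probability $p_i$, that is, $\mathbb P(G_i=k)=(1-p_i)^{k-1}p_i$ for $k\ge 1$. -/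

import Mathlib

open MeasureTheory ProbabilityTheory

/-- The defining relations of Kiselman's semigroup `K_n`; the generator `a_{i+1}` is the letter
`i : Fin n`.  For `j < i`: `a_i a_i = a_i`, `a_i a_j a_i = a_i a_j` and `a_j a_i a_j = a_i a_j`. -/
inductive KiselmanRel (n : ℕ) : FreeMonoid (Fin n) → FreeMonoid (Fin n) → Prop
  | idem (i : Fin n) :
      KiselmanRel n (FreeMonoid.of i * FreeMonoid.of i) (FreeMonoid.of i)
  | left (i j : Fin n) (h : j < i) :
      KiselmanRel n (FreeMonoid.of i * FreeMonoid.of j * FreeMonoid.of i)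
        (FreeMonoid.of i * FreeMonoid.of j)
  | right (i j : Fin n) (h : j < i) :
      KiselmanRel n (FreeMonoid.of j * FreeMonoid.of i * FreeMonoid.of j)
        (FreeMonoid.of i * FreeMonoid.of j)

/-- Kiselman's semigroup `K_n`, as a monoid given by generators and relations. -/
abbrev Kiselman (n : ℕ) : Type := PresentedMonoid (KiselmanRel n)

namespace Kiselman

/-- `K_n` carries the discrete σ-algebra. -/
instance (n : ℕ) : MeasurableSpace (Kiselman n) := ⊤

/-- The canonical generator of `K_n` with (zero-based) index `i`. -/
def gen {n : ℕ} (i : Fin n) : Kiselman n := PresentedMonoid.of (KiselmanRel n) i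

/-- The element `f = e_{[n]} = a_n a_{n-1} ⋯ a_1` of `K_n`. It is the zero element of `K_n`, see
`mul_zeroElt` and `zeroElt_mul`. -/
def zeroElt (n : ℕ) : Kiselman n := ((List.finRange n).reverse.map gen).prod

theorem gen_rel {n : ℕ} {u v : FreeMonoid (Fin n)} (h : KiselmanRel n u v) :
    PresentedMonoid.mk (KiselmanRel n) u = PresentedMonoid.mk (KiselmanRel n) v :=
  Quotient.sound (ConGen.Rel.of _ _ h)

theorem gen_idem {n : ℕ} (i : Fin n) : gen i * gen i = gen i :=
  gen_rel (KiselmanRel.idem i)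

theorem gen_left {n : ℕ} {i j : Fin n} (h : j < i) : gen i * gen j * gen i = gen i * gen j :=
  gen_rel (KiselmanRel.left i j h)

theorem gen_right {n : ℕ} {i j : Fin n} (h : j < i) : gen j * gen i * gen j = gen i * gen j :=
  gen_rel (KiselmanRel.right i j h)

theorem gen_word_gen_of_lt {n : ℕ} (i : Fin n) (w : List (Fin n)) (hw : ∀ j ∈ w, j < i) :
    gen i * (w.map gen).prod * gen i = gen i * (w.map gen).prod := by
  induction w using List.reverseRecOn with
  | nil => simp [gen_idem]
  | append_singleton v j ih =>
    have hv := ih (fun k hk => hw k (by simp [hk]))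
    have hj : j < i := hw j (by simp)
    simp only [List.map_append, List.prod_append, List.map_cons, List.map_nil, List.prod_cons,
      List.prod_nil, mul_one]
    rw [← mul_assoc, ← hv, mul_assoc _ (gen i) (gen j), mul_assoc _ (gen i * gen j) (gen i),
      gen_left hj]

theorem gen_word_gen_of_gt {n : ℕ} (i : Fin n) (w : List (Fin n)) (hw : ∀ j ∈ w, i < j) :
    gen i * (w.map gen).prod * gen i = (w.map gen).prod * gen i := by
  induction w with
  | nil => simp [gen_idem]
  | cons j v ih =>
    have hv := ih (fun k hk => hw k (by simp [hk]))
    have hj : i < j := hw j (by simp)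
    simp only [List.map_cons, List.prod_cons]
    rw [mul_assoc (gen j), ← hv, mul_assoc (gen i) (gen j * _), mul_assoc (gen j), ← hv]
    simp only [← mul_assoc]
    rw [gen_right hj]

theorem zeroElt_mul_gen_and {n : ℕ} (i : Fin n) :
    zeroElt n * gen i = zeroElt n ∧ gen i * zeroElt n = zeroElt n := by
  obtain ⟨s, t, hst⟩ := List.append_of_mem (List.mem_reverse.2 (List.mem_finRange i))
  have hp : ((List.finRange n).reverse).Pairwise (fun a b => b < a) :=
    List.pairwise_reverse.2 (List.pairwise_lt_finRange n)
  rw [hst, List.pairwise_append] at hp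
  obtain ⟨-, hp2, hp3⟩ := hp
  have ht : ∀ j ∈ t, j < i := (List.pairwise_cons.1 hp2).1
  have hs : ∀ j ∈ s, i < j := fun j hj => hp3 j hj i (by simp)
  have hf : zeroElt n = (s.map gen).prod * (gen i * (t.map gen).prod) := by
    simp [zeroElt, hst]
  constructor
  · rw [hf, mul_assoc, gen_word_gen_of_lt i t ht]
  · rw [hf, ← mul_assoc, ← mul_assoc, ← mul_assoc, gen_word_gen_of_gt i s hs]

theorem mul_zeroElt {n : ℕ} (x : Kiselman n) : x * zeroElt n = zeroElt n := by
  induction x using PresentedMonoid.inductionOn with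
  | h w =>
    induction w using FreeMonoid.inductionOn' with
    | one => exact one_mul _
    | of_mul i w ih =>
      rw [map_mul, mul_assoc, ih]
      exact (zeroElt_mul_gen_and i).2

theorem zeroElt_mul {n : ℕ} (x : Kiselman n) : zeroElt n * x = zeroElt n := by
  induction x using PresentedMonoid.inductionOn with
  | h w =>
    induction w using FreeMonoid.inductionOn' with
    | one => exact mul_one _
    | of_mul i w ih =>
      rw [map_mul, ← mul_assoc]
      exact (congrArg (· * _) (zeroElt_mul_gen_and i).1).trans ih

/-- The random partial products `P_0 = e`, `P_{j+1} = P_j X_{j+1}`.  The sequence `X` is indexed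
from `0`, so that `X j` is the factor usually called `X_{j+1}`. -/
def partialProd {n : ℕ} {Ω : Type*} (X : ℕ → Ω → Kiselman n) : ℕ → Ω → Kiselman n
  | 0, _ => 1
  | j + 1, ω => partialProd X j ω * X j ω

/-- The hitting time `T = inf {j ≥ 0 | P_j = f}`, with value `⊤` if `f` is never reached. -/
noncomputable def hittingTime {n : ℕ} {Ω : Type*} (X : ℕ → Ω → Kiselman n) : Ω → ℕ∞ :=
  hittingAfter (partialProd X) {zeroElt n} 0

/-- `p_i = ℙ(X_1 = a_i)`, as an element of the interval `[0, 1]`. -/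
noncomputable def successProb {n : ℕ} {Ω : Type*} [MeasurableSpace Ω] (P : Measure Ω)
    [IsProbabilityMeasure P] (X : ℕ → Ω → Kiselman n) (i : Fin n) : unitInterval :=
  ⟨P.real {ω | X 0 ω = gen i}, measureReal_nonneg, measureReal_le_one⟩

end Kiselman

/-- The geometric law on `{1, 2, 3, …}`: the number of trials up to and including the first
success, with mass `(1 - p) ^ (k - 1) * p` at `k ≥ 1` (for `0 < p`). Mathlib's `geometricMeasure`
counts the failures before the first success. -/
noncomputable def geometricTrialsLaw (p : unitInterval) : Measure ℕ :=
  (geometricMeasure p).map (fun k => k + 1)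

/-!
A word represents the zero element `f = a_n a_{n-1} ⋯ a_1` of `K_n` exactly when it contains
`a_n, a_{n-1}, …, a_1` as a subword, in this order. A greedy reader therefore decides whether
`P_j = f`: it waits for the first `a_n`, from then on for the first `a_{n-1}`, and so on. As the
letters are independent, the waiting time for `a_i` is geometric with success probability `p_i`, and
`T` is the sum of these `n` waiting times.

The greedy reader is `Kiselman.countdown`, the index of the letter waited for (`0` at the end).
Lowering the countdown respects the defining relations, hence is a right action of `K_n` on `ℕ` and
the countdown is a function of the element, not only of the word; this also gives one half of the
criterion `Kiselman.countdown_eq_zero_iff`. For the other half,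
`Kiselman.prod_filter_eq_of_countdown_le` shows by downward induction on `k` that a word whose
countdown reaches `k` represents `a_n ⋯ a_{k+1}` once its letters `a_1, …, a_k` are deleted.

The law of `T` is found without decomposing the trajectory into waiting times. Let `H s m` be the
probability that independent geometric variables with parameters `p_1, …, p_s` have sum at most `m`.
Conditioning on the first trial of the last of them gives
`H (s + 1) (m + 1) = p_{s+1} H s m + (1 - p_{s+1}) H (s + 1) m`
(`measureReal_add_geometric_le_succ`). These are the first-step equations of the countdown, so the
expectation of `H (countdown P_j) m` depends on `j + m` only (`Kiselman.integral_countdown_succ`).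
It equals `ℙ(T ≤ j)` at `(j, 0)` and `H n j` at `(0, j)`.
-/

namespace Kiselman

/-! ### The countdown of an element -/

/-- The effect of reading the letter `i` on a countdown standing at `s`: the value `i + 1` drops to
`i`, every other value is unchanged. -/
def countdownStep {n : ℕ} (i : Fin n) : Function.End ℕ :=
  fun s => if s = i + 1 then i else s

/-- The right action of `K_n` on `ℕ` in which the generator `i` acts by `countdownStep i`. The
opposite monoid makes it a right action: the leftmost letter of a word acts first. -/
def countdownHom (n : ℕ) : Kiselman n →* (Function.End ℕ)ᵐᵒᵖ :=
  PresentedMonoid.lift (M := (Function.End ℕ)ᵐᵒᵖ) (rels := KiselmanRel n)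
      (fun i => MulOpposite.op (countdownStep i)) <| by
    have mul_apply : ∀ (f g : Function.End ℕ) (s : ℕ), (f * g) s = f (g s) := fun _ _ _ => rfl
    rintro _ _ (i | ⟨i, j, h⟩ | ⟨i, j, h⟩) <;>
    · refine MulOpposite.unop_injective (funext fun s => ?_)
      simp only [map_mul, FreeMonoid.lift_eval_of, MulOpposite.unop_mul, MulOpposite.unop_op,
        mul_apply, countdownStep]
      grind

/-- The value reached by the countdown started at `n` after reading a word for `x`. It measures
how much of the word `a_n a_{n-1} ⋯ a_1` is not yet matched by a subword of a word for `x`. -/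
def countdown {n : ℕ} (x : Kiselman n) : ℕ := (countdownHom n x).unop n

theorem countdown_one {n : ℕ} : countdown (1 : Kiselman n) = n := by
  rw [countdown, map_one]
  rfl

theorem countdown_mul_gen {n : ℕ} (x : Kiselman n) (i : Fin n) :
    countdown (x * gen i) = if countdown x = i + 1 then (i : ℕ) else countdown x := by
  simp only [countdown, map_mul, MulOpposite.unop_mul]
  rfl

theorem countdown_mul_gen_le {n : ℕ} (x : Kiselman n) (i : Fin n) :
    countdown (x * gen i) ≤ countdown x := by
  rw [countdown_mul_gen]
  split_ifs <;> omega

theorem exists_word {n : ℕ} (x : Kiselman n) : ∃ w : List (Fin n), (w.map gen).prod = x := by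
  induction x using PresentedMonoid.inductionOn with
  | h w =>
    induction w using FreeMonoid.inductionOn' with
    | one => exact ⟨[], rfl⟩
    | of_mul i w ih =>
      obtain ⟨v, hv⟩ := ih
      exact ⟨i :: v, by rw [List.map_cons, List.prod_cons, hv, map_mul]; rfl⟩

/-- The right-multiplication form of induction on words. -/
theorem induction_mul_gen {n : ℕ} {p : Kiselman n → Prop} (x : Kiselman n) (one : p 1)
    (mul_gen : ∀ x i, p x → p (x * gen i)) : p x := by
  obtain ⟨w, rfl⟩ := exists_word x
  induction w using List.reverseRecOn with
  | nil => exact one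
  | append_singleton v i ih => simpa using mul_gen _ i ih

theorem countdown_le {n : ℕ} (x : Kiselman n) : countdown x ≤ n := by
  induction x using induction_mul_gen with
  | one => exact countdown_one.le
  | mul_gen x i ih => exact (countdown_mul_gen_le x i).trans ih

theorem countdown_zeroElt (n : ℕ) : countdown (zeroElt n) = 0 := by
  by_contra h
  have hle := countdown_le (zeroElt n)
  -- A positive value `s` would be lowered by the letter `s - 1`, but `f` absorbs that letter.
  have key := countdown_mul_gen (zeroElt n) ⟨countdown (zeroElt n) - 1, by omega⟩
  rw [zeroElt_mul, if_pos (by simp only; omega)] at key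
  simp only at key
  omega

/-- The countdown visits every value on its way down: to get to `k` or below, it has to read the
letter `k` while standing at `k + 1`. -/
theorem exists_split_of_countdown_le {n k : ℕ} (hk : k < n) (w : List (Fin n))
    (hw : countdown (w.map gen).prod ≤ k) :
    ∃ u v : List (Fin n), w = u ++ ⟨k, hk⟩ :: v ∧ countdown (u.map gen).prod ≤ k + 1 := by
  induction w using List.reverseRecOn with
  | nil =>
    rw [List.map_nil, List.prod_nil, countdown_one] at hw
    omega
  | append_singleton w i ih =>
    by_cases h : countdown (w.map gen).prod ≤ k
    · obtain ⟨u, v, rfl, hu⟩ := ih h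
      exact ⟨u, v ++ [i], by simp, hu⟩
    · simp only [List.map_append, List.prod_append, List.map_cons, List.map_nil, List.prod_cons,
        List.prod_nil, mul_one, countdown_mul_gen] at hw
      split_ifs at hw with hi
      · obtain rfl : i = ⟨k, hk⟩ := Fin.ext (by simp only; omega)
        exact ⟨w, [], rfl, hi.le⟩
      · omega

/-- In front of the letter `k`, earlier letters `k` can be deleted from a word in
letters `≥ k`. -/
theorem prod_filter_mul_gen {n k : ℕ} (hk : k < n) (w : List (Fin n)) :
    ((w.filter (fun i : Fin n => k ≤ (i : ℕ))).map gen).prod * gen ⟨k, hk⟩ =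
      ((w.filter (fun i : Fin n => k + 1 ≤ (i : ℕ))).map gen).prod * gen ⟨k, hk⟩ := by
  induction w with
  | nil => rfl
  | cons i w ih =>
    rcases lt_trichotomy (i : ℕ) k with h | h | h
    · rw [List.filter_cons_of_neg (by simpa using h),
        List.filter_cons_of_neg (by simp only [decide_eq_true_eq]; omega), ih]
    · obtain rfl : i = ⟨k, hk⟩ := Fin.ext h
      rw [List.filter_cons_of_pos (by simp), List.filter_cons_of_neg (by simp), List.map_cons,
        List.prod_cons, mul_assoc, ih, ← mul_assoc]
      refine gen_word_gen_of_gt _ _ fun j hj => ?_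
      simp only [List.mem_filter, decide_eq_true_eq] at hj
      exact Fin.lt_def.2 hj.2
    · rw [List.filter_cons_of_pos (by simpa using h.le),
        List.filter_cons_of_pos (by simpa using h), List.map_cons, List.prod_cons, List.map_cons,
        List.prod_cons, mul_assoc, ih, mul_assoc]

/-- Two words whose countdowns both reach `k` represent the same element once their letters below
`k` are removed (namely `a_n ⋯ a_{k+1}`). -/
theorem prod_filter_eq_of_countdown_le {n : ℕ} (k : ℕ) (w w' : List (Fin n))
    (hw : countdown (w.map gen).prod ≤ k) (hw' : countdown (w'.map gen).prod ≤ k) :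
    ((w.filter (fun i : Fin n => k ≤ (i : ℕ))).map gen).prod =
      ((w'.filter (fun i : Fin n => k ≤ (i : ℕ))).map gen).prod := by
  obtain ⟨m, hm⟩ : ∃ m, n ≤ k + m := ⟨n, by omega⟩
  induction m generalizing k w w' with
  | zero =>
    have hnil : ∀ v : List (Fin n), v.filter (fun i : Fin n => k ≤ (i : ℕ)) = [] := fun v =>
      List.filter_eq_nil_iff.2 fun i _ => by simp only [decide_eq_true_eq]; omega
    rw [hnil, hnil]
  | succ m ih =>
    by_cases hk : k < n
    swap
    · exact ih k w w' hw hw' (by omega)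
    -- Both sides equal `c * gen k`, where `c` is the common value at `k + 1`.
    obtain ⟨u', v', rfl, hu'⟩ := exists_split_of_countdown_le hk w' hw'
    set c := ((u'.filter (fun i : Fin n => k + 1 ≤ (i : ℕ))).map gen).prod with hc
    suffices H : ∀ w : List (Fin n), countdown (w.map gen).prod ≤ k →
        ((w.filter (fun i : Fin n => k ≤ (i : ℕ))).map gen).prod = c * gen ⟨k, hk⟩ by
      rw [H w hw, H _ hw']
    clear hw w
    intro w hw
    obtain ⟨u, v, rfl, hu⟩ := exists_split_of_countdown_le hk w hw
    have hcu : ((u.filter (fun i : Fin n => k + 1 ≤ (i : ℕ))).map gen).prod = c :=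
      ih (k + 1) u u' hu hu' (by omega)
    -- `c` absorbs the letters above `k`: appending one to a word
    -- keeps its countdown at most `k + 1`.
    have habs : ∀ i : Fin n, k < i → c * gen i = c := by
      intro i hi
      have := ih (k + 1) (u ++ [i]) u' (by
        simpa using (countdown_mul_gen_le _ i).trans hu) hu' (by omega)
      rw [List.filter_append, List.filter_cons_of_pos (by simpa using hi)] at this
      rwa [List.map_append, List.prod_append, hcu, List.filter_nil, List.map_singleton,
        List.prod_singleton, ← hc] at this
    have habs' : ∀ i : Fin n, k ≤ i → c * gen ⟨k, hk⟩ * gen i = c * gen ⟨k, hk⟩ := by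
      intro i hi
      rcases hi.eq_or_lt with h | h
      · obtain rfl : i = ⟨k, hk⟩ := Fin.ext h.symm
        rw [mul_assoc, gen_idem]
      · have hlt : (⟨k, hk⟩ : Fin n) < i := Fin.lt_def.2 h
        conv_lhs => rw [← habs i h]
        rw [mul_assoc c, mul_assoc c, gen_left hlt, ← mul_assoc, habs i h]
    rw [List.filter_append, List.filter_cons_of_pos (by simp), List.map_append, List.prod_append,
      List.map_cons, List.prod_cons, ← mul_assoc, prod_filter_mul_gen, hcu]
    clear hw
    induction v with
    | nil => simp
    | cons i v ihv =>
      by_cases hi : k ≤ (i : ℕ)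
      · rw [List.filter_cons_of_pos (by simpa using hi), List.map_cons, List.prod_cons,
          ← mul_assoc, habs' i hi, ihv]
      · rw [List.filter_cons_of_neg (by simpa using hi), ihv]

/-- The countdown detects the zero element. -/
theorem countdown_eq_zero_iff {n : ℕ} (x : Kiselman n) : countdown x = 0 ↔ x = zeroElt n := by
  refine ⟨fun h => ?_, fun h => h ▸ countdown_zeroElt n⟩
  obtain ⟨w, rfl⟩ := exists_word x
  obtain ⟨w', hw'⟩ := exists_word (zeroElt n)
  rw [← hw']
  simpa using prod_filter_eq_of_countdown_le 0 w w' h.le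
    (by rw [hw', countdown_zeroElt])

theorem gen_injective {n : ℕ} : Function.Injective (gen : Fin n → Kiselman n) := by
  intro i j h
  by_contra hij
  have key : (countdownHom n (gen i)).unop (i + 1) = (countdownHom n (gen j)).unop (i + 1) := by
    rw [h]
  change countdownStep i (i + 1) = countdownStep j (i + 1) at key
  have : (i : ℕ) ≠ j := fun h => hij (Fin.ext h)
  simp only [countdownStep] at key
  split_ifs at key <;> omega

end Kiselman

/-! ### Sums of independent geometric variables -/

theorem measureReal_geometricTrialsLaw_singleton_succ {p : unitInterval} (hp : 0 < p) (k : ℕ) :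
    (geometricTrialsLaw p).real {k + 1} = (1 - p : ℝ) ^ k * p := by
  rw [geometricTrialsLaw,
    map_measureReal_apply (measurable_of_countable _) (measurableSet_singleton _),
    ← geometricMeasure_real_singleton hp.ne']
  congr 1
  ext j
  simp

theorem measureReal_geometricTrialsLaw_singleton_zero (p : unitInterval) :
    (geometricTrialsLaw p).real {0} = 0 := by
  rw [geometricTrialsLaw,
    map_measureReal_apply (measurable_of_countable _) (measurableSet_singleton _)]
  have : (fun k : ℕ => k + 1) ⁻¹' {0} = ∅ := by
    ext j
    simp
  rw [this, measureReal_empty]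

section Geometric

variable {Ω : Type*} [MeasurableSpace Ω] {P : Measure Ω} [IsProbabilityMeasure P] {A G : Ω → ℕ}
  {p : unitInterval}

theorem measureReal_add_geometric_le (hA : Measurable A) (hG : Measurable G)
    (hAG : IndepFun A G P) (hp : 0 < p) (hlaw : HasLaw G (geometricTrialsLaw p) P) (m : ℕ) :
    P.real {ω | A ω + G ω ≤ m} =
      ∑ k ∈ Finset.range m, (1 - p : ℝ) ^ k * p * P.real {ω | A ω ≤ m - 1 - k} := by
  have hGk : ∀ k, P.real (G ⁻¹' {k}) = (geometricTrialsLaw p).real {k} := fun k => by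
    rw [← hlaw.map_eq, map_measureReal_apply hG (measurableSet_singleton k)]
  have hterm : ∀ k, MeasurableSet (G ⁻¹' {k} ∩ A ⁻¹' {a | a + k ≤ m}) := fun k =>
    (hG (measurableSet_singleton k)).inter (hA .of_discrete)
  have hunion : {ω | A ω + G ω ≤ m} =
      ⋃ k ∈ Finset.range (m + 1), G ⁻¹' {k} ∩ A ⁻¹' {a | a + k ≤ m} := by
    ext ω
    simp only [Set.mem_ofPred_eq, Set.mem_iUnion, Finset.mem_range, Set.mem_inter_iff,
      Set.mem_preimage, Set.mem_singleton_iff, exists_prop]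
    constructor
    · exact fun h => ⟨G ω, by omega, rfl, h⟩
    · rintro ⟨k, -, rfl, h⟩
      exact h
  rw [hunion, measureReal_biUnion_finset]
  rotate_left
  · intro k _ l _ hkl
    refine Set.disjoint_left.2 fun ω hk hl => hkl ?_
    exact hk.1.symm.trans hl.1
  · exact fun k _ => hterm k
  have hprod : ∀ k, P.real (G ⁻¹' {k} ∩ A ⁻¹' {a | a + k ≤ m}) =
      (geometricTrialsLaw p).real {k} * P.real (A ⁻¹' {a | a + k ≤ m}) := fun k => by
    rw [← hGk, measureReal_def, hAG.symm.measure_inter_preimage_eq_mul _ _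
      (measurableSet_singleton k) .of_discrete, ENNReal.toReal_mul]
    rfl
  simp only [hprod]
  rw [Finset.sum_range_succ', measureReal_geometricTrialsLaw_singleton_zero, zero_mul, add_zero]
  refine Finset.sum_congr rfl fun k hk => ?_
  rw [measureReal_geometricTrialsLaw_singleton_succ hp]
  congr 2
  ext ω
  have := Finset.mem_range.1 hk
  simp only [Set.mem_preimage, Set.mem_ofPred_eq]
  omega

theorem measureReal_add_geometric_le_zero (hA : Measurable A) (hG : Measurable G)
    (hAG : IndepFun A G P) (hp : 0 < p) (hlaw : HasLaw G (geometricTrialsLaw p) P) :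
    P.real {ω | A ω + G ω ≤ 0} = 0 := by
  rw [measureReal_add_geometric_le hA hG hAG hp hlaw, Finset.sum_range_zero]

/-- First-trial decomposition: the first of the trials counted by `G` succeeds with probability `p`,
and otherwise the remaining number of trials has the law of `G` again. -/
theorem measureReal_add_geometric_le_succ (hA : Measurable A) (hG : Measurable G)
    (hAG : IndepFun A G P) (hp : 0 < p) (hlaw : HasLaw G (geometricTrialsLaw p) P) (m : ℕ) :
    P.real {ω | A ω + G ω ≤ m + 1} =
      p * P.real {ω | A ω ≤ m} + (1 - p) * P.real {ω | A ω + G ω ≤ m} := by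
  rw [measureReal_add_geometric_le hA hG hAG hp hlaw,
    measureReal_add_geometric_le hA hG hAG hp hlaw, Finset.sum_range_succ', Finset.mul_sum,
    add_comm]
  congr 1
  · simp
  · refine Finset.sum_congr rfl fun k _ => ?_
    rw [show m + 1 - 1 - (k + 1) = m - 1 - k by omega]
    ring

end Geometric

namespace Kiselman

/-! ### The hitting time as the end of the countdown -/

instance (n : ℕ) : DiscreteMeasurableSpace (Kiselman n) := ⟨fun _ => trivial⟩

instance (n : ℕ) : Countable (Kiselman n) :=
  Function.Surjective.countable (f := fun w : List (Fin n) => (w.map gen).prod) exists_word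

section HittingTime

variable {n : ℕ} {Ω : Type*}

/-- The σ-algebra on `Ω` is arbitrary, so that this also says that the `j`-th partial product is
measurable with respect to the σ-algebra generated by the first `j` factors. -/
theorem measurable_partialProd [MeasurableSpace Ω] {X : ℕ → Ω → Kiselman n} (j : ℕ)
    (hX : ∀ i < j, Measurable (X i)) : Measurable (partialProd X j) := by
  induction j with
  | zero => exact measurable_const
  | succ j ih =>
    have h1 := ih fun i hi => hX i (by omega)
    exact (Measurable.of_discrete (f := fun q : Kiselman n × Kiselman n => q.1 * q.2)).comp
      (h1.prodMk (hX j (by omega)))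

theorem indepFun_partialProd [MeasurableSpace Ω] {P : Measure Ω} {X : ℕ → Ω → Kiselman n}
    (hX : ∀ j, Measurable (X j)) (hindep : iIndepFun X P) (j : ℕ) :
    IndepFun (partialProd X j) (X j) P := by
  have h := indep_iSup_of_disjoint (fun i => (hX i).comap_le) hindep.iIndep
    (S := Set.Iio j) (T := {j}) (by simp)
  rw [iSup_singleton] at h
  refine indep_of_indep_of_le_left h (Measurable.comap_le ?_)
  refine @measurable_partialProd n Ω (_) X j fun i hi => ?_
  exact (comap_measurable (X i)).mono
    (le_iSup₂_of_le (f := fun i (_ : i ∈ Set.Iio j) => MeasurableSpace.comap (X i) _) i hi le_rfl)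
    le_rfl

theorem partialProd_eq_zeroElt_mono {X : ℕ → Ω → Kiselman n} {ω : Ω} {i j : ℕ} (hij : i ≤ j)
    (h : partialProd X i ω = zeroElt n) : partialProd X j ω = zeroElt n := by
  induction j, hij using Nat.le_induction with
  | base => exact h
  | succ j _ ih => rw [partialProd, ih, zeroElt_mul]

theorem hittingTime_le_iff {X : ℕ → Ω → Kiselman n} {ω : Ω} (j : ℕ) :
    hittingTime X ω ≤ j ↔ countdown (partialProd X j ω) = 0 := by
  rw [countdown_eq_zero_iff]
  constructor
  · intro h
    by_contra hne
    have hlt : ¬ ∃ i ≤ j, partialProd X i ω = zeroElt n :=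
      fun ⟨i, hi, hz⟩ => hne (partialProd_eq_zeroElt_mono hi hz)
    have htop : hittingTime X ω ≠ ⊤ := ne_top_of_le_ne_top (ENat.natCast_ne_top j) h
    have hmem := hittingAfter_mem_set_of_ne_top htop
    obtain ⟨t, ht⟩ := ENat.ne_top_iff_exists.1 htop
    refine hlt ⟨t, by rw [← ht] at h; exact_mod_cast h, ?_⟩
    have ht' : hittingAfter (partialProd X) {zeroElt n} 0 ω = ((t : ℕ) : WithTop ℕ) := ht.symm
    rw [ht'] at hmem
    exact hmem
  · intro h
    exact hittingAfter_le_of_mem (u := partialProd X) (Nat.zero_le j) h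

variable [MeasurableSpace Ω] {P : Measure Ω} [IsProbabilityMeasure P] {X : ℕ → Ω → Kiselman n}

/-- If `H` solves the first-step equations of the countdown, then one more letter read and one more
unit of remaining time have the same effect on the expectation of `H`. The independence of the
partial product and the next factor enters here. -/
theorem integral_countdown_succ (hX_meas : ∀ j, Measurable (X j))
    (hX_gen : ∀ j ω, ∃ i : Fin n, X j ω = gen i) (hX_indep : iIndepFun X P)
    (hX_ident : ∀ j, IdentDistrib (X j) (X 0) P P) (H : ℕ → ℕ → ℝ)
    (H_zero : ∀ m, H 0 (m + 1) = H 0 m)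
    (H_succ : ∀ (i : Fin n) m, H (i + 1) (m + 1) =
      successProb P X i * H i m + (1 - successProb P X i) * H (i + 1) m) (j m : ℕ) :
    ∫ ω, H (countdown (partialProd X (j + 1) ω)) m ∂P =
      ∫ ω, H (countdown (partialProd X j ω)) (m + 1) ∂P := by
  set S : Ω → ℕ := fun ω => countdown (partialProd X j ω)
  have hSmeas : Measurable S :=
    (Measurable.of_discrete (f := countdown)).comp
      (measurable_partialProd j fun i _ => hX_meas i)
  have hSle : ∀ ω, S ω ≤ n := fun ω => countdown_le _
  have hSX : IndepFun S (X j) P :=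
    (indepFun_partialProd hX_meas hX_indep j).comp (φ := countdown) (ψ := id) .of_discrete
      measurable_id
  let E : Fin n → Set Ω := fun i => S ⁻¹' {(i : ℕ) + 1}
  let F : Fin n → Set Ω := fun i => X j ⁻¹' {gen i}
  have hE : ∀ i, MeasurableSet (E i) := fun i => hSmeas (measurableSet_singleton _)
  have hF : ∀ i, MeasurableSet (F i) := fun i => hX_meas j (measurableSet_singleton _)
  have hPF : ∀ i, P.real (F i) = successProb P X i := fun i => by
    rw [measureReal_def, (hX_ident j).measure_mem_eq (measurableSet_singleton _)]
    rfl
  have hPEF : ∀ i, P.real (E i ∩ F i) = P.real (E i) * successProb P X i := fun i => by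
    rw [← hPF, measureReal_def, hSX.measure_inter_preimage_eq_mul _ _
      (measurableSet_singleton _) (measurableSet_singleton _), ENNReal.toReal_mul]
    rfl
  have hint : Integrable (fun ω => H (S ω) m) P := by
    refine Integrable.of_bound
      ((Measurable.of_discrete (f := fun s => H s m)).comp hSmeas).aestronglyMeasurable
      (∑ s ∈ Finset.range (n + 1), ‖H s m‖) (.of_forall fun ω => ?_)
    exact Finset.single_le_sum (f := fun s => ‖H s m‖) (fun _ _ => norm_nonneg _)
      (Finset.mem_range.2 (Nat.lt_succ_of_le (hSle ω)))
  -- Reading one more letter and waiting one more unit of time change `H` by a sum of the same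
  -- increments, over the events `E i ∩ F i` and with weight `p_i` over the events `E i`.
  have hstep : ∀ ω, H (countdown (partialProd X (j + 1) ω)) m = H (S ω) m +
      ∑ i, (E i ∩ F i).indicator (fun _ => H i m - H (i + 1) m) ω := by
    intro ω
    obtain ⟨i₀, hi₀⟩ := hX_gen j ω
    rw [partialProd, hi₀, countdown_mul_gen, Finset.sum_eq_single i₀]
    · by_cases h : S ω = i₀ + 1
      · rw [if_pos h, Set.indicator_of_mem (show ω ∈ E i₀ ∩ F i₀ from ⟨h, hi₀⟩), h]
        ring
      · rw [if_neg h, Set.indicator_of_notMem (fun h' : ω ∈ E i₀ ∩ F i₀ => h h'.1), add_zero]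
    · intro i _ hi
      exact Set.indicator_of_notMem (fun h' => hi (gen_injective (h'.2.symm.trans hi₀))) _
    · simp
  have hwait : ∀ ω, H (S ω) (m + 1) = H (S ω) m +
      ∑ i, (E i).indicator (fun _ => successProb P X i * (H i m - H (i + 1) m)) ω := by
    intro ω
    rcases Nat.eq_zero_or_pos (S ω) with h | h
    · rw [Finset.sum_eq_zero, h, H_zero, add_zero]
      intro i _
      refine Set.indicator_of_notMem (fun h' => ?_) _
      have : S ω = i + 1 := h'
      omega
    · have hi₀ : S ω = (⟨S ω - 1, by have := hSle ω; omega⟩ : Fin n) + 1 := by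
        simp only
        omega
      generalize (⟨S ω - 1, _⟩ : Fin n) = i₀ at hi₀
      rw [Finset.sum_eq_single i₀, Set.indicator_of_mem (show ω ∈ E i₀ from hi₀), hi₀, H_succ]
      · ring
      · intro i _ hi
        refine Set.indicator_of_notMem (fun h' => hi (Fin.ext ?_)) _
        have : S ω = i + 1 := h'
        omega
      · simp
  simp only [hstep]
  rw [show (∫ ω, H (countdown (partialProd X j ω)) (m + 1) ∂P) = ∫ ω, H (S ω) (m + 1) ∂P from rfl]
  simp only [hwait]
  rw [integral_add hint (integrable_finsetSum _ fun i _ =>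
      (integrable_const _).indicator ((hE i).inter (hF i))),
    integral_add hint (integrable_finsetSum _ fun i _ => (integrable_const _).indicator (hE i)),
    integral_finsetSum _ (fun i _ => (integrable_const _).indicator ((hE i).inter (hF i))),
    integral_finsetSum _ (fun i _ => (integrable_const _).indicator (hE i))]
  congr 1
  refine Finset.sum_congr rfl fun i _ => ?_
  rw [integral_indicator_const _ ((hE i).inter (hF i)), integral_indicator_const _ (hE i), hPEF,
    smul_eq_mul, smul_eq_mul]
  ring

/-- A function `H` of the countdown and the time that solves the first-step equations of the
countdown, started from the indicator of countdown `0`, gives the distribution function of the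
hitting time. -/
theorem measureReal_hittingTime_le (hX_meas : ∀ j, Measurable (X j))
    (hX_gen : ∀ j ω, ∃ i : Fin n, X j ω = gen i) (hX_indep : iIndepFun X P)
    (hX_ident : ∀ j, IdentDistrib (X j) (X 0) P P) (H : ℕ → ℕ → ℝ)
    (H_zero : ∀ m, H 0 m = 1) (H_succ_zero : ∀ i : Fin n, H (i + 1) 0 = 0)
    (H_succ : ∀ (i : Fin n) m, H (i + 1) (m + 1) =
      successProb P X i * H i m + (1 - successProb P X i) * H (i + 1) m) (j : ℕ) :
    P.real {ω | hittingTime X ω ≤ j} = H n j := by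
  -- The expectation of `H (countdown P_i) m` depends on `i + m` only.
  have key : ∀ i m, ∫ ω, H (countdown (partialProd X i ω)) m ∂P = H n (i + m) := by
    intro i
    induction i with
    | zero => simp [partialProd, countdown_one]
    | succ i ih =>
      intro m
      rw [integral_countdown_succ hX_meas hX_gen hX_indep hX_ident H (by simp [H_zero]) H_succ, ih,
        show i + (m + 1) = i + 1 + m by ring]
  have hm : MeasurableSet {ω | hittingTime X ω ≤ j} := by
    simp only [hittingTime_le_iff]
    exact measurable_partialProd j (fun i _ => hX_meas i)
      (MeasurableSet.of_discrete (s := {x | countdown x = 0}))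
  rw [← add_zero j, ← key j 0, add_zero, ← integral_indicator_one hm]
  refine integral_congr_ae (.of_forall fun ω => ?_)
  by_cases h : countdown (partialProd X j ω) = 0
  · rw [Set.indicator_of_mem (show ω ∈ {ω | hittingTime X ω ≤ j} from (hittingTime_le_iff j).2 h)]
    simp [h, H_zero]
  · rw [Set.indicator_of_notMem fun h' : ω ∈ {ω | hittingTime X ω ≤ j} =>
      h ((hittingTime_le_iff j).1 h')]
    have hle := countdown_le (partialProd X j ω)
    have := H_succ_zero ⟨countdown (partialProd X j ω) - 1, by omega⟩
    simp only [show countdown (partialProd X j ω) - 1 + 1 = countdown (partialProd X j ω) by omega]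
      at this
    exact this.symm

/-- The `⊤` σ-algebra of `ℕ∞` is its Borel σ-algebra, as `ℕ∞` is countable and `T1`. -/
instance : BorelSpace ℕ∞ := ⟨borel_eq_top_of_countable.symm⟩

theorem measurable_hittingTime (hX_meas : ∀ j, Measurable (X j)) : Measurable (hittingTime X) := by
  have hle : ∀ j : ℕ, MeasurableSet {ω | hittingTime X ω ≤ j} := fun j => by
    simp only [hittingTime_le_iff]
    exact measurable_partialProd j (fun i _ => hX_meas i)
      (MeasurableSet.of_discrete (s := {x | countdown x = 0}))
  refine measurable_of_Iic fun a => ?_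
  induction a using ENat.recTopCoe with
  | top => simp
  | coe j => exact hle j

end HittingTime

end Kiselman

/-- Probability measures on `ℕ∞` are determined by the masses of the sets `{t | t ≤ j}` with `j`
finite. -/
theorem ENat.measure_ext_of_Iic_coe {μ ν : Measure ℕ∞} [IsProbabilityMeasure μ]
    [IsProbabilityMeasure ν] (h : ∀ j : ℕ, μ.real (Set.Iic (j : ℕ∞)) = ν.real (Set.Iic (j : ℕ∞))) :
    μ = ν := by
  refine Measure.ext_of_Iic μ ν fun a => ?_
  induction a using ENat.recTopCoe with
  | top => simp
  | coe j => exact (measureReal_eq_measureReal_iff).1 (h j)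

theorem mainTheorem1 (n : ℕ) (hn : 1 < n)
    {Ω : Type*} [MeasurableSpace Ω] (P : Measure Ω) [IsProbabilityMeasure P]
    (X : ℕ → Ω → Kiselman n)
    (hX_meas : ∀ j, Measurable (X j))
    (hX_gen : ∀ j ω, ∃ i : Fin n, X j ω = Kiselman.gen i)
    (hX_indep : iIndepFun X P)
    (hX_ident : ∀ j, IdentDistrib (X j) (X 0) P P)
    (hp : ∀ i : Fin n, 0 < Kiselman.successProb P X i) :
    ∃ (Ω' : Type) (_ : MeasurableSpace Ω') (P' : Measure Ω') (_ : IsProbabilityMeasure P')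
      (G : Fin n → Ω' → ℕ),
      (∀ i, Measurable (G i)) ∧
      iIndepFun G P' ∧
      (∀ i, HasLaw (G i) (geometricTrialsLaw (Kiselman.successProb P X i)) P') ∧
      IdentDistrib (Kiselman.hittingTime X) (fun ω => ((∑ i, G i ω : ℕ) : ℕ∞)) P P' := by
  have hprob : ∀ i, IsProbabilityMeasure (geometricTrialsLaw (Kiselman.successProb P X i)) :=
    fun i => Measure.isProbabilityMeasure_map (measurable_of_countable _).aemeasurable
  set P' := Measure.pi fun i => geometricTrialsLaw (Kiselman.successProb P X i)
  set G : Fin n → (Fin n → ℕ) → ℕ := fun i ω => ω i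
  have hG_meas : ∀ i, Measurable (G i) := fun i => measurable_pi_apply i
  have hG_indep : iIndepFun G P' := iIndepFun_pi (X := fun _ => id) fun i => aemeasurable_id
  have hG_law : ∀ i, HasLaw (G i) (geometricTrialsLaw (Kiselman.successProb P X i)) P' := fun i =>
    (measurePreserving_eval (fun i => geometricTrialsLaw (Kiselman.successProb P X i)) i).hasLaw
  have hT := Kiselman.measurable_hittingTime hX_meas
  have hsum : Measurable fun ω => ((∑ i, G i ω : ℕ) : ℕ∞) :=
    (Measurable.of_discrete (f := fun k : ℕ => (k : ℕ∞))).comp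
      (Finset.measurable_sum _ fun i _ => hG_meas i)
  refine ⟨Fin n → ℕ, inferInstance, P', inferInstance, G, hG_meas, hG_indep, hG_law,
    hT.aemeasurable, hsum.aemeasurable, ?_⟩
  have := Measure.isProbabilityMeasure_map (μ := P) hT.aemeasurable
  have := Measure.isProbabilityMeasure_map (μ := P') hsum.aemeasurable
  refine ENat.measure_ext_of_Iic_coe fun j => ?_
  rw [map_measureReal_apply hT measurableSet_Iic, map_measureReal_apply hsum measurableSet_Iic]
  -- `A s` is the number of trials a countdown standing at `s` still needs.
  let A : ℕ → (Fin n → ℕ) → ℕ := fun s => ∑ i with (i : Fin n).val < s, G i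
  have hA_meas : ∀ s, Measurable (A s) := fun s => by
    simp only [A, Finset.sum_fn]
    exact Finset.measurable_sum _ fun i _ => hG_meas i
  have hA_succ : ∀ i : Fin n, A (i + 1) = A i + G i := by
    intro i
    have : (Finset.univ.filter fun k : Fin n => k.val < i + 1) =
        insert i (Finset.univ.filter fun k : Fin n => k.val < i) := by
      ext k
      simp only [Finset.mem_filter, Finset.mem_univ, true_and, Finset.mem_insert, Fin.ext_iff]
      omega
    simp only [A, this]
    rw [Finset.sum_insert (by simp), add_comm]
  have hA_indep : ∀ i : Fin n, IndepFun (A i) (G i) P' := fun i =>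
    hG_indep.indepFun_finsetSum_of_notMem hG_meas (by simp)
  refine (Kiselman.measureReal_hittingTime_le hX_meas hX_gen hX_indep hX_ident
    (fun s m => P'.real {ω | A s ω ≤ m}) ?_ ?_ ?_ j).trans ?_
  · simp [A]
  · intro i
    simp only [hA_succ]
    exact measureReal_add_geometric_le_zero (hA_meas i) (hG_meas i) (hA_indep i) (hp i) (hG_law i)
  · intro i m
    simp only [hA_succ]
    exact measureReal_add_geometric_le_succ (hA_meas i) (hG_meas i) (hA_indep i) (hp i)
      (hG_law i) m
  · congr 1
    ext ω
    simp [A]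
    norm_cast
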